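/- Let $\mathbb{T}=(T,m,e)$ be a monad on $\mathsf{Set}$, let $V=(V,\bigvee,\otimes,k)$ be a commutative unital quantale with internal hom determined by $x\otimes y\le z\iff x\le\hom(y,z)$, and let $\xi:TV\to V$ be a function such that $\mathcal{T}=(\mathbb{T},V,\xi)$ is a strict topological theory, that is: (a) $T$ sends pullbacks to weak pullbacks and each naturality square of $m$ is a weak pullback; (b) $(V,\xi)$ is a $\mathbb{T}$-algebra, and $\otimes:V\times V\to V$ and $k:1\to V$ are $\mathbb{T}$-homomorphisms; (c) the maps $V^X\to V^{TX}$, $f\mapsto \xi\cdot Tf$, are monotone, and for all $f:X\to Y$, $\varphi:X\to V$ and $\mathfrak{y}\in TY$, the map $(P_Vf)\varphi:y\mapsto\bigvee_{f(x)=y}\varphi(x)$ satisfies $\xi\cdot T((P_Vf)\varphi)(\mathfrak{y})=\bigvee_{Tf(\mathfrak{x})=\mathfrak{y}}\xi\cdot T\varphi(\mathfrak{x})$. Assume moreover that $T1=1$. Definitions. A $V$-matrix from $X$ to $Y$ is a map $r:Y\times X\to V$, with composition $(s\cdot r)(z,x)=\bigvee_y s(z,y)\otimes r(y,x)$ and entrywise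 order. Put $(T_\xi r)(\mathfrak{y},\mathfrak{x})=\bigvee\{\xi\cdot Tr(\mathfrak{w})\mid \mathfrak{w}\in T(Y\times X),\,T\pi_1(\mathfrak{w})=\mathfrak{y},\,T\pi_2(\mathfrak{w})=\mathfrak{x}\}$. A $\mathcal{T}$-matrix $X\rightharpoonup Y$ is a $V$-matrix from $X$ to $TY$; these compose by $\beta\circ\alpha=m\cdot T_\xi\beta\cdot\alpha$, where functions are regarded as matrices with entries $k$ and $\bot$. A $\mathcal{T}$-graph $(X,a)$ is a set with a $\mathcal{T}$-matrix $a:X\rightharpoonup X$ such that $k\le a(e_X(x),x)$ for all $x$; it is a $\mathcal{T}$-category if moreover $a\circ a\le a$. Its underlying $V$-graph is $(x,y)\mapsto a(e_X(x),y)$. A morphism of $\mathcal{T}$-graphs $f:(X,a)\to(Y,b)$ (called a $\mathcal{T}$-functor between $\mathcal{T}$-categories) is a map with $a(\mathfrak{x},x)\le b(Tf(\mathfrak{x}),f(x))$. A $\mathcal{T}$-distributor $\varphi:(X,a)\rightharpoonup(Y,b)$ is a $\mathcal{T}$-matrix with $\varphi\circ a\le\varphi$ and $b\circ\varphi\le\varphi$;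 it is right adjoint if there is a $\mathcal{T}$-distributor $\psi:(Y,b)\rightharpoonup(X,a)$ with $b\le\varphi\circ\psi$ and $\psi\circ\varphi\le a$. Let $E$ be the one-point $\mathcal{T}$-category with constant structure $k$. The quantale $V$ is a $\mathcal{T}$-graph with structure $(\mathfrak{v},v)\mapsto\hom(\xi(\mathfrak{v}),v)$, and a $\mathbb{T}$-algebra $(I,\alpha)$ is a $\mathcal{T}$-graph whose structure has value $k$ at $(\mathfrak{i},i)$ if $\alpha(\mathfrak{i})=i$, and $\bot$ otherwise. For a $\mathcal{T}$-category $X=(X,a)$, let $\Omega(X)$ be the set of maps $\varphi:X\to V$ that are morphisms of $\mathcal{T}$-graphs, with the $V$-category structure $[\varphi,\varphi']=\bigwedge_{x\in X}\hom(\varphi(x),\varphi'(x))$. This is the underlying $V$-category of the $\mathcal{T}$-graph structure on $\Omega(X)$ given by $$(\mathfrak{p},\varphi)\mapsto\bigwedge\{\hom(a(T\pi_1(\mathfrak{q}),x),\hom(\xi\cdot T\mathrm{ev}(\mathfrak{q}),\varphi(x)))\mid \mathfrak{q}\in T(X\times\Omega(X)),\,T\pi_2(\mathfrak{q})=\mathfrak{p},\,x\in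 X\}.$$ Since $T1=1$, a $\mathcal{T}$-distributor $\varphi:X\rightharpoonup E$ is the same thing as an element of $\Omega(X)$, and for $\mathfrak{x}\in TX$ and $\varphi\in\Omega(X)$ the map $a(\mathfrak{x},-)\otimes\xi\cdot T\varphi(\mathfrak{x})$ belongs to $\Omega(X)$. In a $V$-category $(A,h)$, an element $s$ is an infimum (supremum) of a family $(d_i)_{i\in I}$ if $h(x,s)=\bigwedge_ih(x,d_i)$ (resp. $h(s,x)=\bigwedge_ih(d_i,x)$) for all $x$; and $t$ is a tensor (cotensor) of $x$ with $v\in V$ if $h(t,y)=\hom(v,h(x,y))$ (resp. $h(y,t)=\hom(v,h(y,x))$) for all $y$. A $\mathcal{T}$-diagram in a $\mathcal{T}$-graph $A$ is a morphism of $\mathcal{T}$-graphs $I\to A$ from a $\mathbb{T}$-algebra $I$; a map is $\mathcal{T}$-compatible if composition with it sends $\mathcal{T}$-diagrams to $\mathcal{T}$-diagrams. A map preserves $\mathcal{T}$-suprema if it is $\mathcal{T}$-compatible and preserves suprema of $\mathcal{T}$-diagrams. Proposition. Let $X=(X,a)$ be a $\mathcal{T}$-category and $\Phi:\Omega(X)\to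 V$ a $V$-functor, i.e. $[\varphi,\varphi']\le\hom(\Phi(\varphi),\Phi(\varphi'))$ for all $\varphi,\varphi'\in\Omega(X)$. The following are equivalent. (i) $\Phi=[\varphi,-]$ for some right adjoint $\mathcal{T}$-distributor $\varphi:X\rightharpoonup E$. (ii) $\Phi$ preserves infima, tensors, cotensors and $\mathcal{T}$-suprema. (iii) $\Phi$ preserves infima, tensors and cotensors and, for each $\varphi\in\Omega(X)$, $$\Phi(\varphi)=\bigvee_{\mathfrak{x}\in TX}\Phi\big(a(\mathfrak{x},-)\otimes\xi\cdot T\varphi(\mathfrak{x})\big).\tag{*}$$ -/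

import Mathlib

open CategoryTheory CategoryTheory.Limits

universe u

noncomputable section

namespace TopTheory

/-! ### Weak pullbacks and monads on the category of sets -/

/-- A commutative square is a weak pullback if the cone it defines is a weak limit cone. -/
structure IsWeakPullback {C : Type*} [Category C] {P X Y Z : C}
    (fst : P ⟶ X) (snd : P ⟶ Y) (f : X ⟶ Z) (g : Y ⟶ Z) : Prop where
  w : fst ≫ f = snd ≫ g
  isWeakLimit : Nonempty (IsWeakLimit (PullbackCone.mk fst snd w))

/-- The map `T f : T X → T Y`. -/
def tmap (T : Monad (Type u)) {X Y : Type u} (f : X → Y) (x : T.obj X) : T.obj Y :=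
  T.map (↾f) x

/-- The unit `e_X : X → T X`. -/
def unit (T : Monad (Type u)) {X : Type u} (x : X) : T.obj X := T.η.app X x

/-- The multiplication `m_X : T T X → T X`. -/
def mult (T : Monad (Type u)) {X : Type u} (x : T.obj (T.obj X)) : T.obj X := T.μ.app X x

/-! ### Matrices with entries in a commutative unital quantale -/

section Quantale

variable {V : Type u} [CommMonoid V] [CompleteLattice V] [IsQuantale V]

/-- The internal hom of `V`, characterised by `x * y ≤ z ↔ x ≤ ihom y z`. -/
def ihom (y z : V) : V := Quantale.leftMulResiduation y z

theorem le_ihom_iff {x y z : V} : x ≤ ihom y z ↔ x * y ≤ z :=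
  Quantale.leftMulResiduation_le_iff_mul_le

variable (V) in
/-- `V`-matrices from `X` to `Y`, with entries indexed by `Y × X`, ordered entrywise. -/
abbrev Mat (X Y : Type u) : Type u := Y → X → V

/-- Matrix composition `s · r`. -/
def Mat.comp {X Y Z : Type u} (s : Mat V Y Z) (r : Mat V X Y) : Mat V X Z :=
  fun z x => ⨆ y, s z y * r y x

open Classical in
variable (V) in
/-- A function `f : X → Y` regarded as a matrix from `X` to `Y`. -/
def Mat.ofFun {X Y : Type u} (f : X → Y) : Mat V X Y :=
  fun y x => if f x = y then 1 else ⊥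

/-- The involution on matrices. -/
def Mat.op {X Y : Type u} (r : Mat V X Y) : Mat V Y X := fun x y => r y x

end Quantale

/-! ### Strict topological theories -/

/-- A strict topological theory `(T, V, ξ)` on a monad `T` on sets and a commutative unital
quantale `V`. -/
structure StrictTopologicalTheory (T : Monad (Type u)) (V : Type u)
    [CommMonoid V] [CompleteLattice V] [IsQuantale V] where
  xi : T.obj V → V
  /-- `T` sends pullbacks to weak pullbacks. -/
  map_isPullback : ∀ {P X Y Z : Type u} {fst : P ⟶ X} {snd : P ⟶ Y} {f : X ⟶ Z} {g : Y ⟶ Z},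
    IsPullback fst snd f g → IsWeakPullback (T.map fst) (T.map snd) (T.map f) (T.map g)
  /-- Each naturality square of the multiplication is a weak pullback. -/
  mult_isWeakPullback : ∀ {X Y : Type u} (f : X ⟶ Y),
    IsWeakPullback (T.map (T.map f)) (T.μ.app X) (T.μ.app Y) (T.map f)
  /-- `(V, ξ)` is an Eilenberg-Moore algebra. -/
  xi_unit : ∀ v : V, xi (unit T v) = v
  xi_mult : ∀ w : T.obj (T.obj V), xi (mult T w) = xi (tmap T xi w)
  /-- The multiplication and the unit of the monoid `V` are algebra homomorphisms. -/
  xi_mul : ∀ w : T.obj (V × V),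
    xi (tmap T (fun p : V × V => p.1 * p.2) w) = xi (tmap T Prod.fst w) * xi (tmap T Prod.snd w)
  xi_one : ∀ w : T.obj PUnit.{u + 1}, xi (tmap T (fun _ => (1 : V)) w) = 1
  /-- The maps `f ↦ ξ · T f` are monotone ... -/
  xi_mono : ∀ {X : Type u} {f g : X → V}, f ≤ g → ∀ x : T.obj X, xi (tmap T f x) ≤ xi (tmap T g x)
  /-- ... and natural with respect to direct images
  `(P_V f) φ = fun y => ⨆ {x // f x = y}, φ x`. -/
  xi_natural : ∀ {X Y : Type u} (f : X → Y) (φ : X → V) (y : T.obj Y),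
    xi (tmap T (fun y => ⨆ x : {x : X // f x = y}, φ x) y) =
      ⨆ x : {x : T.obj X // tmap T f x = y}, xi (tmap T φ x)

variable {T : Monad (Type u)} {V : Type u} [CommMonoid V] [CompleteLattice V] [IsQuantale V]

/-- The lax extension `T_ξ` of `T` to `V`-matrices. -/
def laxExt (𝕋 : StrictTopologicalTheory T V) {X Y : Type u} (r : Mat V X Y) :
    Mat V (T.obj X) (T.obj Y) :=
  fun y x => ⨆ w : {w : T.obj (Y × X) // tmap T Prod.fst w = y ∧ tmap T Prod.snd w = x},
    𝕋.xi (tmap T (fun p : Y × X => r p.1 p.2) w)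

variable (T V) in
/-- `T`-matrices `X ⇸ Y` are `V`-matrices from `X` to `T Y`. -/
abbrev TMat (X Y : Type u) : Type u := Mat V X (T.obj Y)

/-- Kleisli composition `β ∘ α = m · T_ξ β · α`. -/
def kleisli (𝕋 : StrictTopologicalTheory T V) {X Y Z : Type u}
    (β : TMat T V Y Z) (α : TMat T V X Y) : TMat T V X Z :=
  Mat.comp (Mat.ofFun V (mult T)) (Mat.comp (laxExt 𝕋 β) α)

/-! ### `T`-graphs, `T`-categories, `T`-functors and `T`-distributors -/

/-- A `T`-graph: a set with a `T`-matrix `a : X ⇸ X` such that `e_X ≤ a`. -/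
structure TGraph (𝕋 : StrictTopologicalTheory T V) where
  carrier : Type u
  str : TMat T V carrier carrier
  refl : Mat.ofFun V (unit T) ≤ str

/-- A `T`-category: a `T`-graph with `a ∘ a ≤ a`. -/
structure TCategory (𝕋 : StrictTopologicalTheory T V) extends TGraph 𝕋 where
  trans : kleisli 𝕋 str str ≤ str

variable {𝕋 : StrictTopologicalTheory T V}

/-- `f` is a morphism of `T`-graphs if `T f · a ≤ b · f`. The `T`-functors between `T`-categories
are the morphisms of the underlying `T`-graphs. -/
def IsGraphMorphism (A B : TGraph 𝕋) (f : A.carrier → B.carrier) : Prop :=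
  Mat.comp (Mat.ofFun V (tmap T f)) A.str ≤ Mat.comp B.str (Mat.ofFun V f)

/-- `φ : X ⇸ Y` is a `T`-distributor if `φ ∘ a ≤ φ` and `b ∘ φ ≤ φ`. -/
def IsDistributor (X Y : TCategory 𝕋) (φ : TMat T V X.carrier Y.carrier) : Prop :=
  kleisli 𝕋 φ X.str ≤ φ ∧ kleisli 𝕋 Y.str φ ≤ φ

/-- `ψ : Y ⇸ X` is left adjoint to `φ : X ⇸ Y` in the locally ordered category of `T`-categories
and `T`-distributors, in which the structure matrices are the identities. -/
def IsAdjunction (X Y : TCategory 𝕋) (ψ : TMat T V Y.carrier X.carrier)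
    (φ : TMat T V X.carrier Y.carrier) : Prop :=
  IsDistributor Y X ψ ∧ IsDistributor X Y φ ∧
    Y.str ≤ kleisli 𝕋 φ ψ ∧ kleisli 𝕋 ψ φ ≤ X.str

/-- `φ` is a right adjoint `T`-distributor. -/
def IsRightAdjointDistributor (X Y : TCategory 𝕋) (φ : TMat T V X.carrier Y.carrier) : Prop :=
  ∃ ψ : TMat T V Y.carrier X.carrier, IsAdjunction X Y ψ φ

/-! Elementary facts used to construct the objects below. -/

theorem tmap_comp {X Y Z : Type u} (g : Y → Z) (f : X → Y) (x : T.obj X) :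
    tmap T g (tmap T f x) = tmap T (fun x => g (f x)) x := by
  unfold tmap
  rw [show (↾(fun x => g (f x)) : X ⟶ Z) = ↾f ≫ ↾g from rfl, CategoryTheory.Functor.map_comp]
  rfl

theorem tmap_id {X : Type u} (x : T.obj X) : tmap T (fun x => x) x = x := by
  unfold tmap
  rw [show (↾(fun x => x) : X ⟶ X) = 𝟙 X from rfl, CategoryTheory.Functor.map_id]
  rfl

theorem tmap_unit {X Y : Type u} (f : X → Y) (x : X) :
    tmap T f (unit T x) = unit T (f x) :=
  (congrArg (fun h : X ⟶ T.obj Y => h x) (T.η.naturality (↾f))).symm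

theorem mult_unit {X : Type u} (x : T.obj X) : mult T (unit T x) = x :=
  congrArg (fun h : T.obj X ⟶ T.obj X => h x) (T.left_unit X)

theorem tmap_mult {X Y : Type u} (f : X → Y) (x : T.obj (T.obj X)) :
    tmap T f (mult T x) = mult T (tmap T (tmap T f) x) :=
  (congrArg (fun h : T.obj (T.obj X) ⟶ T.obj Y => h x) (T.μ.naturality (↾f))).symm

theorem ofFun_le_iff {X Y : Type u} (f : X → Y) (r : Mat V X Y) :
    Mat.ofFun V f ≤ r ↔ ∀ x, 1 ≤ r (f x) x := by
  constructor
  · intro h x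
    simpa [Mat.ofFun] using h (f x) x
  · intro h y x
    unfold Mat.ofFun
    split_ifs with hy
    · exact hy ▸ h x
    · exact bot_le

theorem comp_ofFun {X Y Z : Type u} (r : Mat V Y Z) (f : X → Y) (z : Z) (x : X) :
    Mat.comp r (Mat.ofFun V f) z x = r z (f x) := by
  refine le_antisymm (iSup_le fun y => ?_) (le_iSup_of_le (f x) (by simp [Mat.ofFun]))
  unfold Mat.ofFun
  split_ifs with hy
  · simp [hy]
  · simp [Quantale.mul_bot]

theorem ofFun_comp_le_iff {X Y Z : Type u} (f : Y → Z) (r : Mat V X Y) (s : Mat V X Z) :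
    Mat.comp (Mat.ofFun V f) r ≤ s ↔ ∀ y x, r y x ≤ s (f y) x := by
  constructor
  · intro h y x
    refine le_trans ?_ (h (f y) x)
    exact le_iSup_of_le y (by simp [Mat.ofFun])
  · intro h z x
    refine iSup_le fun y => ?_
    unfold Mat.ofFun
    split_ifs with hy
    · simpa [← hy] using h y x
    · simp [Quantale.bot_mul]

theorem isGraphMorphism_iff (A B : TGraph 𝕋) (f : A.carrier → B.carrier) :
    IsGraphMorphism A B f ↔ ∀ 𝔵 x, A.str 𝔵 x ≤ B.str (tmap T f 𝔵) (f x) := by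
  unfold IsGraphMorphism
  rw [ofFun_comp_le_iff]
  simp only [comp_ofFun]

theorem kleisli_le_iff {X Y Z : Type u} (β : TMat T V Y Z) (α : TMat T V X Y)
    (γ : TMat T V X Z) : kleisli 𝕋 β α ≤ γ ↔
      ∀ (w : T.obj (T.obj Z × Y)) (x : X),
        𝕋.xi (tmap T (fun p : T.obj Z × Y => β p.1 p.2) w) * α (tmap T Prod.snd w) x ≤
          γ (mult T (tmap T Prod.fst w)) x := by
  unfold kleisli
  rw [ofFun_comp_le_iff]
  simp only [Mat.comp, laxExt, Quantale.iSup_mul_distrib, iSup_le_iff]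
  constructor
  · intro h w x
    exact h _ x _ ⟨w, rfl, rfl⟩
  · rintro h _ x _ ⟨w, rfl, rfl⟩
    exact h w x

theorem xi_tmap_mul (𝕋 : StrictTopologicalTheory T V) {X : Type u} (f g : X → V) (x : T.obj X) :
    𝕋.xi (tmap T (fun x => f x * g x) x) = 𝕋.xi (tmap T f x) * 𝕋.xi (tmap T g x) := by
  have h := 𝕋.xi_mul (tmap T (fun x => (f x, g x)) x)
  simpa only [tmap_comp] using h

theorem xi_tmap_one (𝕋 : StrictTopologicalTheory T V) {X : Type u} (x : T.obj X) :
    𝕋.xi (tmap T (fun _ => (1 : V)) x) = 1 := by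
  have h := 𝕋.xi_one (tmap T (fun _ => PUnit.unit) x)
  simpa only [tmap_comp] using h

/-- If `T 1 = 1`, then `T` of a constant map is constant. -/
theorem tmap_const [Subsingleton (T.obj PUnit.{u + 1})] {X Y : Type u} (y : Y) (x : T.obj X) :
    tmap T (fun _ => y) x = unit T y := by
  have h : tmap T (fun _ : X => PUnit.unit.{u + 1}) x = unit T PUnit.unit.{u + 1} :=
    Subsingleton.elim _ _
  have h' := congrArg (tmap T (fun _ => y)) h
  rwa [tmap_comp, tmap_unit] at h'

/-- The elementwise form of the fact that `T` sends the pullback of `{y} → Y` along the projection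
`X × Y → Y` to a weak pullback. -/
theorem exists_tmap_pair (𝕋 : StrictTopologicalTheory T V) {X Y : Type u} (y : Y)
    (w : T.obj (X × Y)) (hw : tmap T Prod.snd w = unit T y) :
    ∃ x : T.obj X, tmap T (fun x => (x, y)) x = w := by
  let i : X ⟶ X × Y := ↾(fun x => (x, y))
  let j : X ⟶ PUnit.{u + 1} := ↾(fun _ => PUnit.unit)
  let p : (X × Y : Type u) ⟶ Y := ↾Prod.snd
  let q : PUnit.{u + 1} ⟶ Y := ↾(fun _ => y)
  have hP : IsPullback i j p q := by
    rw [Types.isPullback_iff]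
    refine ⟨rfl, ?_, ?_⟩
    · intro x x' h
      exact congrArg Prod.fst h.1
    · rintro ⟨x, y'⟩ _ h
      have h' : y' = y := h
      subst h'
      exact ⟨x, rfl, rfl⟩
  obtain ⟨hw', ⟨hl⟩⟩ := 𝕋.map_isPullback hP
  let c : PullbackCone (T.map p) (T.map q) :=
    PullbackCone.mk (W := PUnit.{u + 1}) (↾(fun _ => w)) (↾(fun _ => unit T PUnit.unit)) (by
      ext t
      exact hw.trans (tmap_unit (fun _ : PUnit.{u + 1} => y) PUnit.unit).symm)
  refine ⟨hl.lift c PUnit.unit, ?_⟩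
  exact congrArg (fun h : PUnit.{u + 1} ⟶ T.obj (X × Y) => h PUnit.unit)
    (hl.fac c WalkingCospan.left)

theorem one_le_ihom_self (v : V) : 1 ≤ ihom v v := le_ihom_iff.2 (one_mul v).le

/-! ### The `T`-graphs needed below -/

/-- The `T`-category `E = (1, k)`, with constant structure matrix `k`. -/
def unitCategory (𝕋 : StrictTopologicalTheory T V) : TCategory 𝕋 where
  carrier := PUnit.{u + 1}
  str := fun _ _ => 1
  refl := (ofFun_le_iff _ _).2 fun _ => le_rfl
  trans := (kleisli_le_iff _ _ _).2 fun w x => by rw [xi_tmap_one, mul_one]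

/-- The quantale `V` as a `T`-graph, with structure `hom_ξ (𝔳, v) = hom (ξ 𝔳, v)`. -/
def quantaleGraph (𝕋 : StrictTopologicalTheory T V) : TGraph 𝕋 where
  carrier := V
  str := fun 𝔳 v => ihom (𝕋.xi 𝔳) v
  refl := (ofFun_le_iff _ _).2 fun v => by rw [𝕋.xi_unit]; exact one_le_ihom_self v

/-- An Eilenberg-Moore algebra `α : T I → I` as a `T`-graph, with structure the matrix `α°`. -/
def algebraGraph (𝕋 : StrictTopologicalTheory T V) (I : T.Algebra) : TGraph 𝕋 where
  carrier := I.A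
  str := Mat.op (Mat.ofFun V (fun 𝔦 : T.obj I.A => I.a 𝔦))
  refl := (ofFun_le_iff _ _).2 fun i => by
    have h : I.a (unit T i) = i := congrArg (fun h : I.A ⟶ I.A => h i) I.unit
    simp [Mat.op, Mat.ofFun, h]

/-- The set `Ω(X) = V^X` of `T`-functors from `X` to `V`. -/
def Omega (X : TCategory 𝕋) : Type u :=
  {φ : X.carrier → V // IsGraphMorphism X.toTGraph (quantaleGraph 𝕋) φ}

instance (X : TCategory 𝕋) : CoeFun (Omega X) (fun _ => X.carrier → V) := ⟨fun φ => φ.1⟩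

theorem mem_omega_iff (X : TCategory 𝕋) (φ : X.carrier → V) :
    IsGraphMorphism X.toTGraph (quantaleGraph 𝕋) φ ↔
      ∀ 𝔵 x, X.str 𝔵 x * 𝕋.xi (tmap T φ 𝔵) ≤ φ x := by
  refine (isGraphMorphism_iff X.toTGraph (quantaleGraph 𝕋) φ).trans ?_
  exact forall_congr' fun 𝔵 => forall_congr' fun x => le_ihom_iff

/-- `[φ, φ'] = ⨅ x, hom (φ x, φ' x)`. -/
def bracket {X : Type u} (φ φ' : X → V) : V := ⨅ x, ihom (φ x) (φ' x)

/-- The `V`-category structure of `Ω(X)`, as a full subcategory of the `V`-category of covariant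
`V`-presheaves on the underlying `V`-category of `X`. -/
def Omega.hom {X : TCategory 𝕋} (φ φ' : Omega X) : V := bracket φ.1 φ'.1

/-- The structure matrix of the `T`-graph `V^X`: the value at `(𝔭, φ)` is the infimum, over
all `𝔮 ∈ T (X × V^X)` which project to `𝔭` and all `x ∈ X`, of
`hom (a (T π₁ 𝔮, x), hom (ξ (T ev 𝔮), φ x))`. -/
def Omega.str (X : TCategory 𝕋) : TMat T V (Omega X) (Omega X) :=
  fun 𝔭 φ => ⨅ 𝔮 : {𝔮 : T.obj (X.carrier × Omega X) // tmap T Prod.snd 𝔮 = 𝔭},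
    ⨅ x : X.carrier, ihom (X.str (tmap T Prod.fst 𝔮.1) x)
      (ihom (𝕋.xi (tmap T (fun p : X.carrier × Omega X => p.2 p.1) 𝔮.1)) (φ x))

/-- The underlying `V`-graph of the `T`-graph `V^X` is the `V`-category `Ω(X)`. -/
theorem Omega.str_unit (X : TCategory 𝕋) (φ φ' : Omega X) :
    Omega.str X (unit T φ) φ' = Omega.hom φ φ' := by
  apply le_antisymm
  · refine le_iInf fun x => ?_
    have h : tmap T Prod.snd (unit T (x, φ)) = unit T φ := tmap_unit _ _
    let 𝔮 : {𝔮 : T.obj (X.carrier × Omega X) // tmap T Prod.snd 𝔮 = unit T φ} :=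
      ⟨unit T (x, φ), h⟩
    refine ((iInf_le _ 𝔮).trans (iInf_le _ x)).trans ?_
    change ihom (X.str (tmap T Prod.fst (unit T (x, φ))) x)
      (ihom (𝕋.xi (tmap T (fun p : X.carrier × Omega X => p.2 p.1) (unit T (x, φ)))) (φ' x)) ≤ _
    rw [tmap_unit, tmap_unit, 𝕋.xi_unit]
    set c := ihom (φ x) (φ' x)
    have h1 : 1 ≤ X.str (unit T x) x := (ofFun_le_iff _ _).1 X.refl x
    calc ihom (X.str (unit T x) x) c = ihom (X.str (unit T x) x) c * 1 := (mul_one _).symm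
      _ ≤ ihom (X.str (unit T x) x) c * X.str (unit T x) x := mul_le_mul_right h1 _
      _ ≤ c := le_ihom_iff.1 le_rfl
  · refine le_iInf fun 𝔮 => le_iInf fun x => ?_
    obtain ⟨𝔮, h𝔮⟩ := 𝔮
    obtain ⟨𝔵, rfl⟩ := exists_tmap_pair 𝕋 φ 𝔮 h𝔮
    rw [tmap_comp, tmap_comp, le_ihom_iff, le_ihom_iff, mul_assoc]
    have h := (mem_omega_iff X φ.1).1 φ.2 𝔵 x
    rw [← tmap_id 𝔵] at h
    refine (mul_le_mul_right (by simpa only [tmap_id] using h) _).trans ?_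
    exact le_ihom_iff.1 (iInf_le _ x)

/-- `Ω(X)` as a `T`-graph. -/
def omegaGraph (X : TCategory 𝕋) : TGraph 𝕋 where
  carrier := Omega X
  str := Omega.str X
  refl := (ofFun_le_iff _ _).2 fun φ => by
    rw [Omega.str_unit]
    exact le_iInf fun x => one_le_ihom_self _

/-- The underlying `V`-graph of the `T`-graph `V` is the `V`-category `(V, hom)`. -/
theorem quantaleGraph_str_unit (v v' : V) : (quantaleGraph 𝕋).str (unit T v) v' = ihom v v' :=
  congrArg (fun t => ihom t v') (𝕋.xi_unit v)

/-! ### Limits and colimits in `V`-categories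

A `V`-category is given by its hom-function `A → A → V`. -/

section VCategory

variable {A B I : Type u} (hA : A → A → V) (hB : B → B → V)

/-- `f` is a `V`-functor. -/
def IsVFunctor (f : A → B) : Prop := ∀ x y, hA x y ≤ hB (f x) (f y)

/-- `s` is the infimum of the family `D` in the `V`-category `A`. -/
def IsInfimum (D : I → A) (s : A) : Prop := ∀ x, hA x s = ⨅ i, hA x (D i)

/-- `s` is the supremum of the family `D` in the `V`-category `A`. -/
def IsSupremum (D : I → A) (s : A) : Prop := ∀ x, hA s x = ⨅ i, hA (D i) x

/-- `t` is the tensor of `x` with `v` in the `V`-category `A`. -/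
def IsTensor (v : V) (x t : A) : Prop := ∀ y, hA t y = ihom v (hA x y)

/-- `t` is the cotensor of `x` with `v` in the `V`-category `A`. -/
def IsCotensor (v : V) (x t : A) : Prop := ∀ y, hA y t = ihom v (hA y x)

def PreservesInfima (f : A → B) : Prop :=
  ∀ (I : Type u) (D : I → A) (s : A), IsInfimum hA D s → IsInfimum hB (fun i => f (D i)) (f s)

def PreservesTensors (f : A → B) : Prop :=
  ∀ (v : V) (x t : A), IsTensor hA v x t → IsTensor hB v (f x) (f t)

def PreservesCotensors (f : A → B) : Prop :=
  ∀ (v : V) (x t : A), IsCotensor hA v x t → IsCotensor hB v (f x) (f t)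

end VCategory

/-- The hom-function of the underlying `V`-graph of a `T`-graph. -/
def TGraph.hom (A : TGraph 𝕋) (x y : A.carrier) : V := A.str (unit T x) y

/-- A `T`-diagram in `A`: a morphism of `T`-graphs to `A` from a `T`-algebra. -/
def IsTDiagram (A : TGraph 𝕋) (I : T.Algebra) (D : I.A → A.carrier) : Prop :=
  IsGraphMorphism (algebraGraph 𝕋 I) A D

/-- `f` is `T`-compatible if it sends `T`-diagrams to `T`-diagrams. -/
def IsTCompatible (A B : TGraph 𝕋) (f : A.carrier → B.carrier) : Prop :=
  ∀ (I : T.Algebra) (D : I.A → A.carrier), IsTDiagram A I D → IsTDiagram B I (fun i => f (D i))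

/-- `f` preserves `T`-suprema if it is `T`-compatible and preserves all suprema of `T`-diagrams
which exist in the underlying `V`-category. -/
def PreservesTSuprema (A B : TGraph 𝕋) (f : A.carrier → B.carrier) : Prop :=
  IsTCompatible A B f ∧
    ∀ (I : T.Algebra) (D : I.A → A.carrier) (s : A.carrier), IsTDiagram A I D →
      IsSupremum A.hom D s → IsSupremum B.hom (fun i => f (D i)) (f s)

/-- For `𝔵 ∈ T X` and `φ ∈ Ω(X)`, the element `a (𝔵, -) ⊗ ξ (T φ 𝔵)` of `Ω(X)`. -/
def Omega.approx [Subsingleton (T.obj PUnit.{u + 1})] {X : TCategory 𝕋} (φ : Omega X)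
    (𝔵 : T.obj X.carrier) : Omega X :=
  ⟨fun x => X.str 𝔵 x * 𝕋.xi (tmap T φ 𝔵), by
    rw [mem_omega_iff]
    intro 𝔶 x
    have h := (kleisli_le_iff _ _ _).1 X.trans (tmap T (fun y => (𝔵, y)) 𝔶) x
    simp only [tmap_comp] at h
    rw [tmap_const, mult_unit, tmap_id] at h
    rw [xi_tmap_mul, tmap_const, 𝕋.xi_unit, ← mul_assoc, mul_comm (X.str 𝔶 x)]
    exact mul_le_mul_left h _⟩

end TopTheory

end

/-!
The functional `Φ` preserves infima and cotensors exactly when it is representable,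
`Φ = [φ, -]`, the representing element being the infimum of the cotensors `hom (Φ χ, χ)`
(`exists_representing`). For `φ ∈ Ω(X)` there is only one candidate for the left adjoint
`ψ : E ⇸ X` of the distributor `φ : X ⇸ E`, namely `ψ 𝔵 = [φ, a (𝔵, -)]`. It is always a distributor
with `ψ ∘ φ ≤ a`, so `φ` is right adjoint if and only if
`k ≤ ⋁ 𝔵, ξ (T φ 𝔵) ⊗ [φ, a (𝔵, -)]`
(`one_le_iSup_of_isRightAdjoint`, `isRightAdjoint_of_one_le_iSup`). When `Φ = [φ, -]` preserves
tensors, this inequality is `k ≤ Φ φ` combined, at `χ = φ`, with the formula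
`Φ χ = ⋁ 𝔵, Φ (a (𝔵, -) ⊗ ξ (T χ 𝔵))`.
Conversely, the inequality yields the expansion
`[φ, χ] = ⋁ 𝔵, ξ (T χ 𝔵) ⊗ [φ, a (𝔵, -)]`
(`hom_eq_iSup`), from which preservation of tensors is read off.

Preservation of `T`-suprema rests on the fact that the pointwise supremum of a `T`-diagram in `Ω(X)`
again lies in `Ω(X)` (`Omega.iSup`), because `ξ` commutes with direct images; the expansion above
then shows that `[φ, -]` preserves it. In the other direction, every `χ ∈ Ω(X)` is the supremum of
the family `𝔵 ↦ a (𝔵, -) ⊗ ξ (T χ 𝔵)`, and this family is a `T`-diagram indexed by the free algebra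
on `X` (`isTDiagram_approx`), since `T` sends pullbacks to weak pullbacks and `a ∘ a ≤ a`. Hence the
formula above is an instance of preservation of `T`-suprema.
-/

namespace TopTheory

/-! ### The internal hom of the quantale -/

section Quantale

variable {V : Type u} [CommMonoid V] [CompleteLattice V] [IsQuantale V]

theorem ihom_mul_le (y z : V) : ihom y z * y ≤ z := le_ihom_iff.1 le_rfl

theorem one_le_ihom_iff {x y : V} : 1 ≤ ihom x y ↔ x ≤ y := by
  rw [le_ihom_iff, one_mul]

theorem ihom_mul (v x y : V) : ihom (v * x) y = ihom v (ihom x y) :=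
  eq_of_forall_le_iff fun z => by simp only [le_ihom_iff, mul_assoc]

theorem ihom_iInf {ι : Type*} (v : V) (d : ι → V) : ihom v (⨅ i, d i) = ⨅ i, ihom v (d i) :=
  eq_of_forall_le_iff fun z => by simp only [le_ihom_iff, le_iInf_iff]

theorem ihom_iSup {ι : Type*} (d : ι → V) (v : V) : ihom (⨆ i, d i) v = ⨅ i, ihom (d i) v :=
  eq_of_forall_le_iff fun z => by
    simp only [le_ihom_iff, le_iInf_iff, Quantale.mul_iSup_distrib, iSup_le_iff]

theorem eq_of_ihom_right_eq {x y : V} (h : ∀ z, ihom z x = ihom z y) : x = y :=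
  eq_of_forall_le_iff fun z => by rw [← one_le_ihom_iff, h, one_le_ihom_iff]

theorem eq_of_ihom_left_eq {x y : V} (h : ∀ z, ihom x z = ihom y z) : x = y :=
  eq_of_forall_ge_iff fun z => by rw [← one_le_ihom_iff, h, one_le_ihom_iff]

theorem isInfimum_ihom_iff {I : Type u} {D : I → V} {s : V} :
    IsInfimum ihom D s ↔ s = ⨅ i, D i := by
  simp only [IsInfimum, ← ihom_iInf]
  exact ⟨eq_of_ihom_right_eq, fun h x => by rw [h]⟩

theorem isSupremum_ihom_iff {I : Type u} {D : I → V} {s : V} :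
    IsSupremum ihom D s ↔ s = ⨆ i, D i := by
  simp only [IsSupremum, ← ihom_iSup]
  exact ⟨eq_of_ihom_left_eq, fun h x => by rw [h]⟩

theorem isTensor_ihom_iff {v x t : V} : IsTensor ihom v x t ↔ t = v * x := by
  simp only [IsTensor, ← ihom_mul]
  exact ⟨eq_of_ihom_left_eq, fun h y => by rw [h]⟩

theorem isCotensor_ihom_iff {v x t : V} : IsCotensor ihom v x t ↔ t = ihom v x := by
  have h (y : V) : ihom v (ihom y x) = ihom y (ihom v x) := by
    rw [← ihom_mul, mul_comm, ihom_mul]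
  simp only [IsCotensor, h]
  exact ⟨eq_of_ihom_right_eq, fun h y => by rw [h]⟩

theorem le_bracket_iff {X : Type u} {φ χ : X → V} {v : V} :
    v ≤ bracket φ χ ↔ ∀ x, v * φ x ≤ χ x := by
  simp only [bracket, le_iInf_iff, le_ihom_iff]

theorem bracket_mul_le {X : Type u} (φ χ : X → V) (x : X) : bracket φ χ * φ x ≤ χ x :=
  le_bracket_iff.1 le_rfl x

end Quantale

variable {T : Monad (Type u)} {V : Type u} [CommMonoid V] [CompleteLattice V] [IsQuantale V]
variable {𝕋 : StrictTopologicalTheory T V}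

/-! ### Elementwise consequences of the axioms of a theory -/

theorem xi_tmap_const [Subsingleton (T.obj PUnit.{u + 1})] (𝕋 : StrictTopologicalTheory T V)
    {X : Type u} (v : V) (x : T.obj X) : 𝕋.xi (tmap T (fun _ => v) x) = v := by
  rw [tmap_const, 𝕋.xi_unit]

theorem xi_tmap_const_mul [Subsingleton (T.obj PUnit.{u + 1})] (𝕋 : StrictTopologicalTheory T V)
    {X : Type u} (v : V) (f : X → V) (x : T.obj X) :
    𝕋.xi (tmap T (fun x => v * f x) x) = v * 𝕋.xi (tmap T f x) := by
  rw [xi_tmap_mul, xi_tmap_const]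

/-- The map `φ ↦ ξ · T φ` is a `V`-functor; this uses `T 1 = 1`. -/
theorem bracket_mul_xi_le [Subsingleton (T.obj PUnit.{u + 1})] (𝕋 : StrictTopologicalTheory T V)
    {X : Type u} (φ χ : X → V) (x : T.obj X) :
    bracket φ χ * 𝕋.xi (tmap T φ x) ≤ 𝕋.xi (tmap T χ x) := by
  rw [← xi_tmap_const_mul]
  exact 𝕋.xi_mono (bracket_mul_le φ χ) x

/-- The elementwise form of the fact that `T` sends the pullback of `D : I → Y` along the
projection `X × Y → Y` to a weak pullback. -/
theorem exists_tmap_map_id (𝕋 : StrictTopologicalTheory T V) {X Y I : Type u} (D : I → Y)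
    (𝔮 : T.obj (X × Y)) (𝔦 : T.obj I) (h : tmap T Prod.snd 𝔮 = tmap T D 𝔦) :
    ∃ w : T.obj (X × I), tmap T (fun p => (p.1, D p.2)) w = 𝔮 ∧ tmap T Prod.snd w = 𝔦 := by
  let i : (X × I : Type u) ⟶ (X × Y : Type u) := ↾(fun p => (p.1, D p.2))
  let j : (X × I : Type u) ⟶ I := ↾Prod.snd
  let p : (X × Y : Type u) ⟶ Y := ↾Prod.snd
  let q : I ⟶ Y := ↾D
  have hP : IsPullback i j p q := by
    rw [Types.isPullback_iff]
    refine ⟨rfl, ?_, ?_⟩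
    · rintro ⟨x, k⟩ ⟨x', k'⟩ h
      have h₁ : (x, D k) = (x', D k') := h.1
      exact Prod.ext (Prod.mk.inj h₁).1 h.2
    · rintro ⟨x, y⟩ k h
      have h' : y = D k := h
      subst h'
      exact ⟨(x, k), rfl, rfl⟩
  obtain ⟨_, ⟨hl⟩⟩ := 𝕋.map_isPullback hP
  let c : PullbackCone (T.map p) (T.map q) :=
    PullbackCone.mk (W := PUnit.{u + 1}) (↾(fun _ => 𝔮)) (↾(fun _ => 𝔦)) (by
      ext t
      exact h)
  exact ⟨hl.lift c PUnit.unit,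
    congrArg (fun h : PUnit.{u + 1} ⟶ T.obj (X × Y) => h PUnit.unit)
      (hl.fac c WalkingCospan.left),
    congrArg (fun h : PUnit.{u + 1} ⟶ T.obj I => h PUnit.unit)
      (hl.fac c WalkingCospan.right)⟩

theorem le_kleisli {X Y Z : Type u} (β : TMat T V Y Z) (α : TMat T V X Y)
    (w : T.obj (T.obj Z × Y)) (x : X) :
    𝕋.xi (tmap T (fun p : T.obj Z × Y => β p.1 p.2) w) * α (tmap T Prod.snd w) x ≤
      kleisli 𝕋 β α (mult T (tmap T Prod.fst w)) x :=
  (kleisli_le_iff _ _ _).1 le_rfl w x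

theorem TCategory.one_le_str (X : TCategory 𝕋) (x : X.carrier) : 1 ≤ X.str (unit T x) x :=
  (ofFun_le_iff _ _).1 X.refl x

theorem TCategory.xi_mul_str_le (X : TCategory 𝕋) (w : T.obj (T.obj X.carrier × X.carrier))
    (x : X.carrier) :
    𝕋.xi (tmap T (fun p : T.obj X.carrier × X.carrier => X.str p.1 p.2) w) *
      X.str (tmap T Prod.snd w) x ≤ X.str (mult T (tmap T Prod.fst w)) x :=
  (kleisli_le_iff _ _ _).1 X.trans w x

/-! ### Elements of `Ω(X)` -/

namespace Omega

variable {X : TCategory 𝕋}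

theorem str_mul_xi_le (φ : Omega X) (𝔵 : T.obj X.carrier) (x : X.carrier) :
    X.str 𝔵 x * 𝕋.xi (tmap T φ 𝔵) ≤ φ x :=
  (mem_omega_iff X φ.1).1 φ.2 𝔵 x

theorem one_le_hom_iff {φ χ : Omega X} : 1 ≤ hom φ χ ↔ ∀ x, φ x ≤ χ x := by
  simp only [hom, le_bracket_iff, one_mul]

theorem eq_of_hom_left_eq {φ χ : Omega X} (h : ∀ υ, hom φ υ = hom χ υ) : φ = χ := by
  have h₁ : 1 ≤ hom φ χ := by rw [h]; exact one_le_hom_iff.2 fun _ => le_rfl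
  have h₂ : 1 ≤ hom χ φ := by rw [← h]; exact one_le_hom_iff.2 fun _ => le_rfl
  exact Subtype.ext (funext fun x =>
    le_antisymm (one_le_hom_iff.1 h₁ x) (one_le_hom_iff.1 h₂ x))

/-- The pointwise infimum of a family in `Ω(X)`. -/
def iInf {I : Type u} (D : I → Omega X) : Omega X :=
  ⟨fun x => ⨅ i, D i x, (mem_omega_iff X _).2 fun 𝔵 x => le_iInf fun i =>
    (mul_le_mul_right (𝕋.xi_mono (fun y => iInf_le (fun i => D i y) i) 𝔵) _).trans
      (str_mul_xi_le (D i) 𝔵 x)⟩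

theorem isInfimum_iInf {I : Type u} (D : I → Omega X) : IsInfimum hom D (iInf D) := fun φ =>
  eq_of_forall_le_iff fun v => by
    simp only [hom, le_iInf_iff, le_bracket_iff, iInf]
    exact forall_comm

theorem hom_eq_iInf_of_eq_iSup {I : Type u} {D : I → Omega X} {φ : Omega X}
    (h : ∀ x, φ x = ⨆ i, D i x) (χ : Omega X) : hom φ χ = ⨅ i, hom (D i) χ :=
  eq_of_forall_le_iff fun v => by
    simp only [hom, le_iInf_iff, le_bracket_iff, h, Quantale.mul_iSup_distrib, iSup_le_iff]
    exact forall_comm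

section

variable [Subsingleton (T.obj PUnit.{u + 1})]

/-- The pointwise tensor `v ⊗ φ` of an element of `Ω(X)`. -/
def tensor (v : V) (φ : Omega X) : Omega X :=
  ⟨fun x => v * φ x, (mem_omega_iff X _).2 fun 𝔵 x => by
    rw [xi_tmap_const_mul, mul_left_comm]
    exact mul_le_mul_right (str_mul_xi_le φ 𝔵 x) v⟩

theorem isTensor_tensor (v : V) (φ : Omega X) : IsTensor hom v φ (tensor v φ) := fun χ =>
  eq_of_forall_le_iff fun z => by
    simp only [hom, le_ihom_iff, le_bracket_iff, tensor, mul_assoc]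

/-- The pointwise cotensor `hom (v, φ)` of an element of `Ω(X)`. -/
def cotensor (v : V) (φ : Omega X) : Omega X :=
  ⟨fun x => ihom v (φ x), (mem_omega_iff X _).2 fun 𝔵 x => by
    rw [le_ihom_iff, mul_assoc]
    refine le_trans (mul_le_mul_right ?_ _) (str_mul_xi_le φ 𝔵 x)
    rw [mul_comm, ← xi_tmap_const_mul]
    exact 𝕋.xi_mono (fun y => (mul_comm _ _).le.trans (ihom_mul_le v (φ y))) 𝔵⟩

theorem isCotensor_cotensor (v : V) (φ : Omega X) : IsCotensor hom v φ (cotensor v φ) := fun χ =>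
  eq_of_forall_le_iff fun z => by
    simp only [hom, le_ihom_iff, le_bracket_iff, cotensor, mul_right_comm]

variable (X) in
/-- The element `a (𝔵, -)` of `Ω(X)`. -/
def corep (𝔵 : T.obj X.carrier) : Omega X :=
  ⟨X.str 𝔵, (mem_omega_iff X _).2 fun 𝔶 x => by
    have h := X.xi_mul_str_le (tmap T (fun y => (𝔵, y)) 𝔶) x
    simp only [tmap_comp] at h
    rwa [tmap_const, mult_unit, tmap_id, mul_comm] at h⟩

theorem approx_eq_tensor (φ : Omega X) (𝔵 : T.obj X.carrier) :
    φ.approx 𝔵 = tensor (𝕋.xi (tmap T φ 𝔵)) (corep X 𝔵) :=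
  Subtype.ext (funext fun _ => mul_comm _ _)

/-- Every element of `Ω(X)` is the pointwise supremum of its approximations; it is attained at
the points `e_X x`. -/
theorem eq_iSup_approx (φ : Omega X) (x : X.carrier) : φ x = ⨆ 𝔵, φ.approx 𝔵 x := by
  refine le_antisymm (le_iSup_of_le (unit T x) ?_) (iSup_le fun 𝔵 => str_mul_xi_le φ 𝔵 x)
  change φ x ≤ X.str (unit T x) x * 𝕋.xi (tmap T φ (unit T x))
  rw [tmap_unit, 𝕋.xi_unit]
  exact le_mul_of_one_le_left' (X.one_le_str x)

end

theorem le_str_iff {𝔭 : T.obj (Omega X)} {χ : Omega X} {v : V} :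
    v ≤ str X 𝔭 χ ↔ ∀ 𝔮 : T.obj (X.carrier × Omega X), tmap T Prod.snd 𝔮 = 𝔭 → ∀ x,
      v * X.str (tmap T Prod.fst 𝔮) x *
        𝕋.xi (tmap T (fun p : X.carrier × Omega X => p.2 p.1) 𝔮) ≤ χ x := by
  simp only [str, le_iInf_iff, le_ihom_iff, Subtype.forall]

end Omega

/-! ### Diagrams in `Ω(X)` and their suprema -/

theorem isTDiagram_iff (A : TGraph 𝕋) (I : T.Algebra) (D : I.A → A.carrier) :
    IsTDiagram A I D ↔ ∀ 𝔦 : T.obj I.A, 1 ≤ A.str (tmap T D 𝔦) (D (I.a 𝔦)) :=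
  (isGraphMorphism_iff _ _ _).trans <| forall_comm.trans <|
    ofFun_le_iff (fun 𝔦 : T.obj I.A => I.a 𝔦) (fun i 𝔦 => A.str (tmap T D 𝔦) (D i))

/-- A family `D` in `Ω(X)` is a `T`-diagram if and only if the matrix `(x, i) ↦ D i x` satisfies the
inequality defining elements of `Ω(X)` jointly in `x` and `i`. -/
theorem isTDiagram_omegaGraph_iff (X : TCategory 𝕋) (I : T.Algebra) (D : I.A → Omega X) :
    IsTDiagram (omegaGraph X) I D ↔ ∀ (w : T.obj (X.carrier × I.A)) (x : X.carrier),
      X.str (tmap T Prod.fst w) x *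
          𝕋.xi (tmap T (fun p : X.carrier × I.A => D p.2 p.1) w) ≤
        D (I.a (tmap T Prod.snd w)) x := by
  refine (isTDiagram_iff _ _ _).trans ⟨fun h w x => ?_, fun h 𝔦 => Omega.le_str_iff.2 ?_⟩
  · have h' := Omega.le_str_iff.1 (h (tmap T Prod.snd w))
      (tmap T (fun p => (p.1, D p.2)) w)
      ((tmap_comp _ _ w).trans (tmap_comp D Prod.snd w).symm) x
    simpa only [tmap_comp, one_mul] using h'
  · intro 𝔮 h𝔮 x
    obtain ⟨w, rfl, rfl⟩ := exists_tmap_map_id 𝕋 D 𝔮 𝔦 h𝔮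
    simpa only [tmap_comp, one_mul] using h w x

/-- The supremum `⋁ i, f x i` is the direct image of `f` along the projection `X × I → X`, with
which `ξ` is compatible. -/
theorem xi_tmap_iSup (𝕋 : StrictTopologicalTheory T V) {X I : Type u} (f : X → I → V)
    (𝔵 : T.obj X) :
    𝕋.xi (tmap T (fun x => ⨆ i, f x i) 𝔵) =
      ⨆ w : {w : T.obj (X × I) // tmap T Prod.fst w = 𝔵},
        𝕋.xi (tmap T (fun p : X × I => f p.1 p.2) w) := by
  rw [← 𝕋.xi_natural Prod.fst (fun p : X × I => f p.1 p.2) 𝔵]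
  congr 2
  funext x
  refine le_antisymm (iSup_le fun i => le_iSup_of_le ⟨(x, i), rfl⟩ le_rfl) (iSup_le ?_)
  rintro ⟨⟨_, i⟩, rfl⟩
  exact le_iSup_of_le i le_rfl

/-- The pointwise supremum of a `T`-diagram in `Ω(X)`. -/
def Omega.iSup {X : TCategory 𝕋} {I : T.Algebra} (D : I.A → Omega X)
    (hD : IsTDiagram (omegaGraph X) I D) : Omega X :=
  ⟨fun x => ⨆ i, D i x, (mem_omega_iff X _).2 fun 𝔵 x => by
    rw [xi_tmap_iSup 𝕋 (fun x i => D i x), Quantale.mul_iSup_distrib]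
    refine iSup_le ?_
    rintro ⟨w, rfl⟩
    exact le_iSup_of_le (I.a (tmap T Prod.snd w))
      ((isTDiagram_omegaGraph_iff X I D).1 hD w x)⟩

theorem omegaGraph_hom (X : TCategory 𝕋) : (omegaGraph X).hom = Omega.hom (X := X) :=
  funext₂ fun φ χ => Omega.str_unit X φ χ

theorem isSupremum_quantaleGraph_iff {I : Type u} {D : I → V} {s : V} :
    IsSupremum (quantaleGraph 𝕋).hom D s ↔ s = ⨆ i, D i := by
  have h : (ihom : V → V → V) = (quantaleGraph 𝕋).hom :=
    funext₂ fun v v' => (quantaleGraph_str_unit v v').symm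
  exact Iff.trans (iff_of_eq (congrArg (fun k : V → V → V => IsSupremum k D s) h.symm))
    isSupremum_ihom_iff

/-- The approximations of `φ ∈ Ω(X)` form a `T`-diagram indexed by the free algebra on `X`. -/
theorem isTDiagram_approx [Subsingleton (T.obj PUnit.{u + 1})] {X : TCategory 𝕋} (φ : Omega X) :
    IsTDiagram (omegaGraph X) (T.free.obj X.carrier) φ.approx := by
  refine (isTDiagram_omegaGraph_iff X _ _).2 fun (w : T.obj (X.carrier × T.obj X.carrier)) x => ?_
  change X.str (tmap T Prod.fst w) x * 𝕋.xi (tmap T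
      (fun p : X.carrier × T.obj X.carrier => X.str p.2 p.1 * 𝕋.xi (tmap T φ p.2)) w) ≤
    X.str (mult T (tmap T Prod.snd w)) x * 𝕋.xi (tmap T φ (mult T (tmap T Prod.snd w)))
  have h := X.xi_mul_str_le (tmap T Prod.swap w) x
  simp only [tmap_comp, Prod.fst_swap, Prod.snd_swap] at h
  rw [tmap_mult, 𝕋.xi_mult]
  simp only [tmap_comp]
  rw [xi_tmap_mul, ← mul_assoc, mul_comm (X.str _ _)]
  exact mul_le_mul_left h _

/-! ### Limits preserved by representable functionals -/

theorem preservesInfima_hom {X : TCategory 𝕋} (φ : Omega X) :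
    PreservesInfima Omega.hom ihom (Omega.hom φ : Omega X → V) :=
  fun _ _ _ h => isInfimum_ihom_iff.2 (h φ)

theorem preservesCotensors_hom {X : TCategory 𝕋} (φ : Omega X) :
    PreservesCotensors Omega.hom ihom (Omega.hom φ : Omega X → V) :=
  fun _ _ _ h => isCotensor_ihom_iff.2 (h φ)

/-! ### Right adjoint distributors into the one-point category -/

section

variable [Subsingleton (T.obj PUnit.{u + 1})] {X : TCategory 𝕋}

/-- The unit inequality of the adjunction survives when the left adjoint is replaced by
`𝔵 ↦ [φ, a (𝔵, -)]`, because the counit inequality makes the latter the larger one. -/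
theorem one_le_iSup_of_isRightAdjoint {φ : TMat T V X.carrier PUnit.{u + 1}}
    (h : IsRightAdjointDistributor X (unitCategory 𝕋) φ) :
    1 ≤ ⨆ 𝔵, 𝕋.xi (tmap T (φ (unit T PUnit.unit)) 𝔵) *
      bracket (φ (unit T PUnit.unit)) (X.str 𝔵) := by
  obtain ⟨ψ, -, -, hunit, hcounit⟩ := h
  have hψ (𝔵 : T.obj X.carrier) :
      ψ 𝔵 PUnit.unit ≤ bracket (φ (unit T PUnit.unit)) (X.str 𝔵) := by
    refine le_bracket_iff.2 fun x => ?_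
    have h := (kleisli_le_iff _ _ _).1 hcounit (unit T (𝔵, PUnit.unit)) x
    simp only [tmap_unit, 𝕋.xi_unit, mult_unit] at h
    exact h
  refine (hunit (unit T PUnit.unit) PUnit.unit).trans ?_
  refine (kleisli_le_iff φ ψ (fun _ _ => ⨆ 𝔵, 𝕋.xi (tmap T (φ (unit T PUnit.unit)) 𝔵) *
      bracket (φ (unit T PUnit.unit)) (X.str 𝔵))).2 (fun w _ => ?_) _ _
  refine le_iSup_of_le (tmap T Prod.snd w) (mul_le_mul' (le_of_eq ?_) (hψ _))
  rw [tmap_comp]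
  congr 2
  funext p
  rw [Subsingleton.elim p.1 (unit T PUnit.unit)]

theorem mem_omega_of_isDistributor {φ : TMat T V X.carrier PUnit.{u + 1}}
    (h : IsDistributor X (unitCategory 𝕋) φ) :
    IsGraphMorphism X.toTGraph (quantaleGraph 𝕋) (φ (unit T PUnit.unit)) := by
  refine (mem_omega_iff X _).2 fun 𝔵 x => ?_
  have h' := (kleisli_le_iff _ _ _).1 h.1 (tmap T (fun x => (unit T PUnit.unit, x)) 𝔵) x
  simp only [tmap_comp] at h'
  rw [tmap_id, tmap_const, mult_unit, mul_comm] at h'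
  exact h'

/-- The map `𝔵 ↦ [φ, a (𝔵, -)]` is always a distributor satisfying the counit inequality; the
hypothesis is the unit inequality. -/
theorem isRightAdjoint_of_one_le_iSup (φ : Omega X)
    (h : 1 ≤ ⨆ 𝔵, 𝕋.xi (tmap T φ 𝔵) * bracket φ.1 (X.str 𝔵)) :
    IsRightAdjointDistributor X (unitCategory 𝕋) (fun _ => φ.1) := by
  -- The counit inequality; combined with the definition of `[φ, a (𝔵, -)]`, it is also
  -- compatibility of the left adjoint with the structure of the one-point category.
  have key (𝔛 : T.obj (T.obj X.carrier)) (x : X.carrier) :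
      𝕋.xi (tmap T (fun 𝔵 => bracket φ.1 (X.str 𝔵)) 𝔛) * φ x ≤ X.str (mult T 𝔛) x := by
    have h' := X.xi_mul_str_le (tmap T (fun 𝔵 => (𝔵, x)) 𝔛) x
    simp only [tmap_comp] at h'
    rw [tmap_const, tmap_id] at h'
    refine le_trans ?_ ((le_mul_of_one_le_right' (X.one_le_str x)).trans h')
    rw [mul_comm, ← xi_tmap_const_mul]
    exact 𝕋.xi_mono (fun 𝔵 => (mul_comm _ _).le.trans (bracket_mul_le φ.1 (X.str 𝔵) x)) 𝔛
  refine ⟨fun 𝔵 _ => bracket φ.1 (X.str 𝔵), ⟨?_, ?_⟩, ⟨?_, ?_⟩, ?_, ?_⟩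
  · refine (kleisli_le_iff _ _ _).2 fun w _ => ?_
    refine le_bracket_iff.2 fun x => ?_
    have h' := key (tmap T Prod.fst w) x
    rw [tmap_comp] at h'
    simpa only [unitCategory, mul_one] using h'
  · refine (kleisli_le_iff _ _ _).2 fun w _ => ?_
    refine le_bracket_iff.2 fun x => ?_
    rw [mul_assoc]
    exact (mul_le_mul_right (bracket_mul_le _ _ x) _).trans (X.xi_mul_str_le w x)
  · refine (kleisli_le_iff _ _ _).2 fun w x => ?_
    have h' := φ.str_mul_xi_le (tmap T Prod.snd w) x
    rw [tmap_comp, mul_comm] at h'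
    exact h'
  · refine (kleisli_le_iff _ _ _).2 fun w x => ?_
    refine le_of_eq ?_
    change 𝕋.xi (tmap T (fun _ => (1 : V)) w) * φ x = φ x
    exact (congrArg (· * φ x) (xi_tmap_one 𝕋 w)).trans (one_mul _)
  · intro (𝔢 : T.obj PUnit.{u + 1}) _
    refine h.trans (iSup_le fun 𝔵 => ?_)
    have h' := le_kleisli (𝕋 := 𝕋) (fun _ : T.obj PUnit.{u + 1} => φ.1)
      (fun 𝔵 (_ : PUnit.{u + 1}) => bracket φ.1 (X.str 𝔵))
      (tmap T (fun x => (unit T PUnit.unit, x)) 𝔵) PUnit.unit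
    simp only [tmap_comp] at h'
    rw [tmap_id] at h'
    rw [Subsingleton.elim 𝔢 (mult T (tmap T (fun _ => unit T PUnit.unit) 𝔵))]
    exact h'
  · refine (kleisli_le_iff _ _ _).2 fun w x => ?_
    have h' := key (tmap T Prod.fst w) x
    rw [tmap_comp] at h'
    exact h'

/-! ### Representable functionals -/

/-- The representing element is the infimum, over all `χ`, of the cotensors of `χ` with `Φ χ`. -/
theorem exists_representing {Φ : Omega X → V} (hΦ : IsVFunctor Omega.hom ihom Φ)
    (hinf : PreservesInfima Omega.hom ihom Φ) (hcot : PreservesCotensors Omega.hom ihom Φ) :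
    ∃ φ : Omega X, Φ = Omega.hom φ := by
  refine ⟨Omega.iInf fun χ => Omega.cotensor (Φ χ) χ, funext fun χ => le_antisymm ?_ ?_⟩
  · refine le_bracket_iff.2 fun x => ?_
    rw [mul_comm]
    exact (mul_le_mul_left (iInf_le _ χ) _).trans (ihom_mul_le (Φ χ) (χ x))
  · refine (hΦ _ _).trans ?_
    have h1 : 1 ≤ Φ (Omega.iInf fun χ => Omega.cotensor (Φ χ) χ) := by
      rw [isInfimum_ihom_iff.1 (hinf _ _ _ (Omega.isInfimum_iInf _))]
      refine le_iInf fun χ => ?_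
      rw [isCotensor_ihom_iff.1 (hcot _ _ _ (Omega.isCotensor_cotensor _ _))]
      exact one_le_ihom_self _
    exact (le_mul_of_one_le_right' h1).trans (ihom_mul_le _ _)

theorem apply_approx {Φ : Omega X → V} (h : PreservesTensors Omega.hom ihom Φ) (χ : Omega X)
    (𝔵 : T.obj X.carrier) :
    Φ (χ.approx 𝔵) = 𝕋.xi (tmap T χ 𝔵) * Φ (Omega.corep X 𝔵) := by
  rw [Omega.approx_eq_tensor]
  exact isTensor_ihom_iff.1 (h _ _ _ (Omega.isTensor_tensor _ _))

section

variable {φ : Omega X}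

/-- If `φ` is right adjoint, then `[φ, χ]` is the composite of `χ` with the left adjoint of `φ`. -/
theorem hom_eq_iSup (h : 1 ≤ ⨆ 𝔵, 𝕋.xi (tmap T φ 𝔵) * bracket φ.1 (X.str 𝔵)) (χ : Omega X) :
    Omega.hom φ χ = ⨆ 𝔵, 𝕋.xi (tmap T χ 𝔵) * bracket φ.1 (X.str 𝔵) := by
  refine le_antisymm ((le_mul_of_one_le_right' h).trans ?_) (iSup_le fun 𝔵 => ?_)
  · rw [Quantale.mul_iSup_distrib]
    refine iSup_mono fun 𝔵 => ?_
    rw [← mul_assoc]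
    exact mul_le_mul_left (bracket_mul_xi_le 𝕋 φ.1 χ.1 𝔵) _
  · refine le_bracket_iff.2 fun x => ?_
    rw [mul_assoc, mul_comm]
    exact (mul_le_mul_left (bracket_mul_le φ.1 (X.str 𝔵) x) _).trans (χ.str_mul_xi_le 𝔵 x)

theorem preservesTensors_hom
    (h : 1 ≤ ⨆ 𝔵, 𝕋.xi (tmap T φ 𝔵) * bracket φ.1 (X.str 𝔵)) :
    PreservesTensors Omega.hom ihom (Omega.hom φ : Omega X → V) := by
  intro v χ t ht
  have h_eq : t = Omega.tensor v χ :=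
    Omega.eq_of_hom_left_eq fun υ => (ht υ).trans (Omega.isTensor_tensor v χ υ).symm
  subst h_eq
  refine isTensor_ihom_iff.2 ?_
  rw [hom_eq_iSup h, hom_eq_iSup h, Quantale.mul_iSup_distrib]
  refine iSup_congr fun 𝔵 => ?_
  rw [← mul_assoc, ← xi_tmap_const_mul]
  rfl

variable (φ) in
/-- The functional `[φ, -]` is a morphism of `T`-graphs from `Ω(X)` to `V`. -/
theorem str_mul_xi_hom_le (𝔭 : T.obj (Omega X)) (χ : Omega X) :
    Omega.str X 𝔭 χ * 𝕋.xi (tmap T (Omega.hom φ : Omega X → V) 𝔭) ≤ Omega.hom φ χ := by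
  refine le_bracket_iff.2 fun x => ?_
  -- The element of `T (X × Ω(X))` over `𝔭` whose first projection is `e_X x`.
  have h := Omega.le_str_iff.1 (le_refl (Omega.str X 𝔭 χ)) (tmap T (fun χ => (x, χ)) 𝔭)
    (by rw [tmap_comp, tmap_id]) x
  simp only [tmap_comp] at h
  rw [tmap_const] at h
  refine le_trans ?_ h
  rw [mul_assoc]
  refine mul_le_mul' (le_mul_of_one_le_right' (X.one_le_str x)) ?_
  rw [mul_comm, ← xi_tmap_const_mul]
  exact 𝕋.xi_mono (fun χ => (mul_comm _ _).le.trans (bracket_mul_le φ.1 χ.1 x)) 𝔭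

variable (φ) in
theorem isTCompatible_hom :
    IsTCompatible (omegaGraph X) (quantaleGraph 𝕋) (Omega.hom φ : Omega X → V) := by
  intro I D hD
  rw [isTDiagram_iff] at hD
  refine (isTDiagram_iff _ _ _).2 fun 𝔦 => ?_
  refine one_le_ihom_iff.2 ?_
  have h := (mul_le_mul_left (hD 𝔦) _).trans (str_mul_xi_hom_le φ (tmap T D 𝔦) (D (I.a 𝔦)))
  rw [one_mul] at h
  exact (congrArg 𝕋.xi (tmap_comp _ _ 𝔦)).ge.trans h

theorem preservesTSuprema_hom
    (h : 1 ≤ ⨆ 𝔵, 𝕋.xi (tmap T φ 𝔵) * bracket φ.1 (X.str 𝔵)) :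
    PreservesTSuprema (omegaGraph X) (quantaleGraph 𝕋) (Omega.hom φ : Omega X → V) := by
  refine ⟨isTCompatible_hom φ, fun I (D : I.A → Omega X) (s : Omega X) hD hs => ?_⟩
  rw [omegaGraph_hom] at hs
  have h_eq : s = Omega.iSup D hD := Omega.eq_of_hom_left_eq fun υ =>
    (hs υ).trans (Omega.hom_eq_iInf_of_eq_iSup (φ := Omega.iSup D hD) (fun _ => rfl) υ).symm
  subst h_eq
  refine isSupremum_quantaleGraph_iff.2 (le_antisymm ?_ (iSup_le fun i => ?_))
  · rw [hom_eq_iSup h]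
    refine iSup_le fun 𝔵 => ?_
    change 𝕋.xi (tmap T (fun x => ⨆ i, D i x) 𝔵) * _ ≤ _
    rw [xi_tmap_iSup 𝕋 (fun x i => D i x), Quantale.iSup_mul_distrib]
    refine iSup_le ?_
    rintro ⟨w, rfl⟩
    refine le_iSup_of_le (I.a (tmap T Prod.snd w)) (le_bracket_iff.2 fun x => ?_)
    rw [mul_assoc, mul_comm]
    exact (mul_le_mul_left (bracket_mul_le φ.1 _ x) _).trans
      ((isTDiagram_omegaGraph_iff X I D).1 hD w x)
  · exact le_bracket_iff.2 fun x =>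
      (bracket_mul_le φ.1 (D i).1 x).trans (le_iSup (fun i => D i x) i)

end

theorem eq_iSup_approx_of_preservesTSuprema {Φ : Omega X → V}
    (h : PreservesTSuprema (omegaGraph X) (quantaleGraph 𝕋) Φ) (χ : Omega X) :
    Φ χ = ⨆ 𝔵, Φ (χ.approx 𝔵) := by
  have h' : IsSupremum Omega.hom χ.approx χ := Omega.hom_eq_iInf_of_eq_iSup χ.eq_iSup_approx
  rw [← omegaGraph_hom] at h'
  have hs := h.2 (T.free.obj X.carrier) χ.approx χ (isTDiagram_approx χ) h'
  exact isSupremum_quantaleGraph_iff.1 hs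

end

end TopTheory

theorem mainTheorem2 {T : CategoryTheory.Monad (Type u)} {V : Type u}
    [CommMonoid V] [CompleteLattice V] [IsQuantale V]
    (𝕋 : TopTheory.StrictTopologicalTheory T V)
    [Subsingleton (T.obj PUnit.{u + 1})]
    (X : TopTheory.TCategory 𝕋)
    (Φ : TopTheory.Omega X → V)
    (hΦ : TopTheory.IsVFunctor TopTheory.Omega.hom TopTheory.ihom Φ) :
    List.TFAE [
      ∃ φ : TopTheory.TMat T V X.carrier PUnit.{u + 1},
        TopTheory.IsRightAdjointDistributor X (TopTheory.unitCategory 𝕋) φ ∧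
        ∀ φ' : TopTheory.Omega X,
          Φ φ' = TopTheory.bracket (φ (TopTheory.unit T PUnit.unit)) φ',
      TopTheory.PreservesInfima TopTheory.Omega.hom TopTheory.ihom Φ ∧
        TopTheory.PreservesTensors TopTheory.Omega.hom TopTheory.ihom Φ ∧
        TopTheory.PreservesCotensors TopTheory.Omega.hom TopTheory.ihom Φ ∧
        TopTheory.PreservesTSuprema (TopTheory.omegaGraph X) (TopTheory.quantaleGraph 𝕋) Φ,
      TopTheory.PreservesInfima TopTheory.Omega.hom TopTheory.ihom Φ ∧
        TopTheory.PreservesTensors TopTheory.Omega.hom TopTheory.ihom Φ ∧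
        TopTheory.PreservesCotensors TopTheory.Omega.hom TopTheory.ihom Φ ∧
        ∀ φ : TopTheory.Omega X,
          Φ φ = ⨆ 𝔵 : T.obj X.carrier, Φ (φ.approx 𝔵)] := by
  tfae_have 1 → 2 := by
    rintro ⟨φ, hφ, h⟩
    have hone := TopTheory.one_le_iSup_of_isRightAdjoint hφ
    have hmem := TopTheory.mem_omega_of_isDistributor hφ.choose_spec.2.1
    obtain rfl : Φ = TopTheory.Omega.hom ⟨_, hmem⟩ := funext h
    exact ⟨TopTheory.preservesInfima_hom _, TopTheory.preservesTensors_hom hone,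
      TopTheory.preservesCotensors_hom _, TopTheory.preservesTSuprema_hom hone⟩
  tfae_have 2 → 3 := fun ⟨hinf, hten, hcot, hsup⟩ =>
    ⟨hinf, hten, hcot, TopTheory.eq_iSup_approx_of_preservesTSuprema hsup⟩
  tfae_have 3 → 1 := by
    rintro ⟨hinf, hten, hcot, happrox⟩
    obtain ⟨φ, rfl⟩ := TopTheory.exists_representing hΦ hinf hcot
    refine ⟨fun _ => φ.1, TopTheory.isRightAdjoint_of_one_le_iSup φ ?_, fun _ => rfl⟩
    refine (TopTheory.Omega.one_le_hom_iff.2 fun _ => le_rfl : 1 ≤ TopTheory.Omega.hom φ φ).trans ?_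
    rw [happrox φ]
    exact (iSup_congr (TopTheory.apply_approx hten φ)).le
  tfae_finish
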